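/- Let $n$ be the number of potential contestants, and let $M$ be a rank-order contest with prizes $v_1,\dots,v_n\in\mathbb R$. Each agent $i$ privately learns her type $(q_i,c_i)\in\mathbb R^2$, where $q_i$ is the quality of her output if she participates and $c_i$ is her cost of participating; the types are independent draws from a probability distribution $F$ on $\mathbb R^2$. The agents simultaneously decide whether to participate. A participant whose output has the $k$-th highest quality among all participants receives $v_k$ (ties in quality, which have probability zero below, are broken uniformly at random), so that her payoff is $v_k-c_i$; an agent who does not participate has payoff $0$. A mixed strategy is a random pure strategy, that is, a jointly measurable map $(\omega,(q,c))\mapsto\sigma_\omega(q,c)\in\{0,1\}$, where $1$ means "participate" and $\omega$ is the outcome of a private randomization device, uniform on $[0,1]$; the devices of different agents are independent of each other and of the types. Assume that $F$ is absolutely continuous with respect to Lebesgue measure on $\mathbb R^2$. Then $M$ has a symmetric mixed-strategy equilibrium: there is a mixed strategy $\mu$ such that, if all agents play $\mu$, then for every agent $i$, every type $(q,c)$ and every mixed strategy $\tau$, the expected payoff of agent $i$ conditional on having type $(q,c)$ does not increase when she alone deviates from $\mu$ to $\tau$. -/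

import Mathlib

open MeasureTheory

noncomputable section

namespace Contest

/-- An agent's type `(q, c)`: the quality `q` of her output if she participates, and her cost `c`
of participating. -/
abbrev AgentType : Type := ℝ × ℝ

/-- A rank-order contest among `n` potential contestants: `prize k` is awarded to the participant
whose output has rank `k + 1` (so `prize 0` goes to the highest quality). Non-participants
receive nothing, and prizes of ranks that are not filled are not awarded. -/
structure RankOrderContest (n : ℕ) where
  prize : Fin n → ℝ

variable {n : ℕ}

/-- The prize of a participating agent `i` when the qualities are `q` and the participants are the
agents `j` with `a j = true`. If `above` participants have strictly higher quality and `tied` other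
participants have the same quality, then the tied agents occupy the (zero-based) ranks
`above, …, above + tied` in uniformly random order, and `i` gets the average of these prizes.
Without ties this is `prize above`. -/
def RankOrderContest.prizeOf (M : RankOrderContest n) (q : Fin n → ℝ) (a : Fin n → Bool)
    (i : Fin n) : ℝ :=
  let above : ℕ := (Finset.univ.filter fun j => a j = true ∧ q i < q j).card
  let tied : ℕ := (Finset.univ.filter fun j => j ≠ i ∧ a j = true ∧ q j = q i).card
  (∑ k ∈ Finset.univ.filter (fun k : Fin n => above ≤ (k : ℕ) ∧ (k : ℕ) ≤ above + tied),
    M.prize k) / ((tied : ℝ) + 1)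

/-- Ex-post utility of agent `i` for types `t` and participation decisions `a`: prize minus cost
if she participates, and zero otherwise. -/
def RankOrderContest.utility (M : RankOrderContest n) (t : Fin n → AgentType) (a : Fin n → Bool)
    (i : Fin n) : ℝ :=
  if a i = true then M.prizeOf (fun j => (t j).1) a i - (t i).2 else 0

/-- A mixed strategy is a random pure strategy: `play ω : AgentType → Bool` is the pure
strategy (`true` means "participate") chosen at the outcome `ω` of a private randomization
device, uniform on `[0, 1]`; the decision depends measurably on `(ω, type)`. -/
structure MixedStrategy where
  play : unitInterval → AgentType → Bool
  measurable_play : Measurable (Function.uncurry play)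

/-- Expected utility of agent `i`, given that her type is `x`, under the profile `s` of mixed
strategies: the types of the other agents are independent draws from `F`, and the
randomization devices of all agents are independent, and independent of the types.
(The `i`-th sampled type is overwritten with `x`.) -/
def RankOrderContest.payoff (M : RankOrderContest n) (F : Measure AgentType)
    (s : Fin n → MixedStrategy) (i : Fin n) (x : AgentType) : ℝ :=
  ∫ z : (Fin n → AgentType) × (Fin n → unitInterval),
    M.utility (Function.update z.1 i x)
      (fun j => (s j).play (z.2 j) (Function.update z.1 i x j)) i
    ∂((Measure.pi fun _ : Fin n => F).prod
      (Measure.pi fun _ : Fin n => (volume : Measure unitInterval)))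

/-- The profile `s` is a (Bayes–Nash) equilibrium in mixed strategies: no agent, whatever her type,
gains by a unilateral deviation to another mixed strategy. -/
def RankOrderContest.IsEquilibrium (M : RankOrderContest n) (F : Measure AgentType)
    (s : Fin n → MixedStrategy) : Prop :=
  ∀ (i : Fin n) (x : AgentType) (τ : MixedStrategy),
    M.payoff F (Function.update s i τ) i x ≤ M.payoff F s i x

/-- A mixed strategy `μ` is a symmetric equilibrium if all agents playing `μ` (with independent
randomization) is an equilibrium. -/
def RankOrderContest.IsSymmetricEquilibrium (M : RankOrderContest n) (F : Measure AgentType)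
    (μ : MixedStrategy) : Prop :=
  M.IsEquilibrium F fun _ => μ

end Contest

end

/-!
The equilibrium is pure: participate iff `c ≤ V (G q)`, where `G q` is the probability that a given
opponent participates with quality above `q`, and `V g = M.expectedPrize g` is the expected prize
of a participant when each of the other `n - 1` agents independently outranks her with
probability `g`. Since `F` has no atoms in the quality, ties are negligible, the number of agents
above a participant of quality `q` is binomial with parameters `n - 1` and `G q`, and the payoff
from a strategy `τ` is the probability that `τ` participates times `V (G q) - c`
(`RankOrderContest.payoff_eq`). The cutoff rule maximizes this for every type.

It remains to find a consistent `G`, that is, to solve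
`G q = F {(q', c') | q < q', c' ≤ V (G q')}` (`exists_eq_measureReal`). This is a scalar
Carathéodory differential equation run downwards from `q = +∞`, and it is solved by Tonelli's
method. With `G q'` replaced by `G (q' + 1 / (k + 1))`, and qualities above `k` discarded, the
equation is solved on `[-k, ∞)` by finitely many steps of iteration (`delayIter`). All approximate
solutions have increments bounded by those of the distribution function of the quality, which is
continuous, so a subsequence converges pointwise (`exists_subseq_tendsto`). The limit is a solution
by dominated convergence, because the cutoff curve `c' = V (G q')` is Lebesgue null and hence
`F`-null.
-/

namespace Contest

open Set Filter Topology

/-! ### The expected prize -/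

variable {n : ℕ}

/-- The prize of a participant with `m` participants above her, extended by zero to `n ≤ m`. -/
noncomputable def RankOrderContest.rankPrize (M : RankOrderContest n) (m : ℕ) : ℝ :=
  if h : m < n then M.prize ⟨m, h⟩ else 0

/-- The expected prize of a participant if each of the other `n - 1` agents independently
participates with a higher quality with probability `g`. -/
noncomputable def RankOrderContest.expectedPrize (M : RankOrderContest n) (g : ℝ) : ℝ :=
  ∑ m ∈ Finset.range n, ((n - 1).choose m : ℝ) * (g ^ m * (1 - g) ^ (n - 1 - m)) * M.rankPrize m

lemma RankOrderContest.continuous_expectedPrize (M : RankOrderContest n) :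
    Continuous M.expectedPrize := by
  unfold RankOrderContest.expectedPrize
  fun_prop

lemma RankOrderContest.prizeOf_of_no_ties (M : RankOrderContest n) (q : Fin n → ℝ)
    (a : Fin n → Bool) (i : Fin n) (h : ∀ j, j ≠ i → q j ≠ q i) :
    M.prizeOf q a i =
      M.rankPrize (Finset.univ.filter fun j => j ≠ i ∧ a j = true ∧ q i < q j).card := by
  have htied : (Finset.univ.filter fun j => j ≠ i ∧ a j = true ∧ q j = q i) = ∅ := by
    ext j
    simp only [Finset.mem_filter, Finset.mem_univ, true_and, Finset.notMem_empty, iff_false]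
    exact fun hj => h j hj.1 hj.2.2
  have habove : (Finset.univ.filter fun j => a j = true ∧ q i < q j) =
      Finset.univ.filter fun j => j ≠ i ∧ a j = true ∧ q i < q j := by
    ext j
    simp only [Finset.mem_filter, Finset.mem_univ, true_and]
    exact ⟨fun hj => ⟨fun e => by simp [e] at hj, hj⟩, fun hj => hj.2⟩
  have hlt : (Finset.univ.filter fun j => j ≠ i ∧ a j = true ∧ q i < q j).card < n := by
    have : (Finset.univ.filter fun j => j ≠ i ∧ a j = true ∧ q i < q j) ⊂ Finset.univ :=
      Finset.filter_ssubset.2 ⟨i, Finset.mem_univ i, by simp⟩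
    simpa using Finset.card_lt_card this
  simp only [RankOrderContest.prizeOf, RankOrderContest.rankPrize, htied, habove, hlt,
    Finset.card_empty, add_zero, Nat.cast_zero, zero_add, div_one, dif_pos]
  rw [Finset.sum_eq_single ⟨_, hlt⟩]
  · intro k hk hne
    simp only [Finset.mem_filter, Finset.mem_univ, true_and] at hk
    exact absurd (Fin.ext (le_antisymm hk.2 hk.1)) hne
  · intro hk
    simp at hk

/-- The number of opponents of `i` with types in `B` is binomial: the integral is split according
to the set `S` of these opponents, each event being a cylinder in the product space. -/
lemma RankOrderContest.integral_rankPrize_card (M : RankOrderContest n) (F : Measure AgentType)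
    [IsProbabilityMeasure F] {B : Set AgentType} [DecidablePred (· ∈ B)] (hB : MeasurableSet B)
    (i : Fin n) :
    Integrable (fun z : Fin n → AgentType =>
      M.rankPrize (Finset.univ.filter fun j => j ≠ i ∧ z j ∈ B).card)
      (Measure.pi fun _ : Fin n => F) ∧
    ∫ z : Fin n → AgentType, M.rankPrize (Finset.univ.filter fun j => j ≠ i ∧ z j ∈ B).card
      ∂(Measure.pi fun _ : Fin n => F) = M.expectedPrize (F.real B) := by
  set E : Finset (Fin n) → Set (Fin n → AgentType) := fun S =>
    Set.univ.pi fun j => if j = i then Set.univ else if j ∈ S then B else Bᶜ with hE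
  have hEm : ∀ S, MeasurableSet (E S) := fun S =>
    MeasurableSet.univ_pi fun j => by split_ifs <;> simp [hB]
  have hmem : ∀ z : Fin n → AgentType, ∀ S ∈ (Finset.univ.erase i).powerset,
      z ∈ E S ↔ S = Finset.univ.filter fun j => j ≠ i ∧ z j ∈ B := by
    intro z S hS
    have hiS : i ∉ S := fun hi => by simpa using Finset.mem_powerset.1 hS hi
    simp only [hE, Set.mem_univ_pi, Finset.ext_iff, Finset.mem_filter, Finset.mem_univ, true_and]
    refine forall_congr' fun j => ?_
    by_cases hji : j = i
    · subst hji; simp [hiS]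
    · by_cases hjS : j ∈ S <;> simp [hji, hjS]
  have hdecomp : ∀ z : Fin n → AgentType,
      M.rankPrize (Finset.univ.filter fun j => j ≠ i ∧ z j ∈ B).card =
      ∑ S ∈ (Finset.univ.erase i).powerset, (E S).indicator (fun _ => M.rankPrize S.card) z := by
    intro z
    rw [Finset.sum_eq_single (Finset.univ.filter fun j => j ≠ i ∧ z j ∈ B)]
    · rw [Set.indicator_of_mem]
      exact (hmem z _ (by simp +contextual [Finset.subset_iff])).2 rfl
    · intro S hS hne
      exact Set.indicator_of_notMem (fun hz => hne ((hmem z S hS).1 hz)) _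
    · intro hS
      simp +contextual [Finset.subset_iff] at hS
  have hprob : ∀ S ∈ (Finset.univ.erase i).powerset,
      (Measure.pi fun _ : Fin n => F).real (E S) =
        F.real B ^ S.card * (1 - F.real B) ^ (n - 1 - S.card) := by
    intro S hS
    have hSi := Finset.mem_powerset.1 hS
    have hc : F.real Bᶜ = 1 - F.real B := by
      rw [measureReal_compl hB]; simp
    rw [Measure.real, hE, Measure.pi_pi, ENNReal.toReal_prod,
      ← Finset.mul_prod_erase _ _ (Finset.mem_univ i)]
    have hcard : ((Finset.univ.erase i) \ S).card = n - 1 - S.card := by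
      rw [Finset.card_sdiff_of_subset hSi]; simp
    rw [← Finset.prod_sdiff hSi, ← hcard]
    have h1 : ∏ j ∈ S, (F (if j = i then Set.univ else if j ∈ S then B else Bᶜ)).toReal =
        F.real B ^ S.card := by
      refine Finset.prod_eq_pow_card fun j hj => ?_
      simp [Finset.ne_of_mem_erase (hSi hj), hj, Measure.real]
    have h2 : ∏ j ∈ (Finset.univ.erase i) \ S,
        (F (if j = i then Set.univ else if j ∈ S then B else Bᶜ)).toReal =
        (1 - F.real B) ^ ((Finset.univ.erase i) \ S).card := by
      refine Finset.prod_eq_pow_card fun j hj => ?_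
      rw [Finset.mem_sdiff] at hj
      simpa [Finset.ne_of_mem_erase hj.1, hj.2, Measure.real] using hc
    rw [h1, h2]
    simp [mul_comm]
  simp_rw [hdecomp]
  have hint : ∀ S ∈ (Finset.univ.erase i).powerset, Integrable
      ((E S).indicator fun _ => M.rankPrize S.card) (Measure.pi fun _ : Fin n => F) :=
    fun S _ => (integrable_const _).indicator (hEm S)
  refine ⟨integrable_finsetSum _ hint, ?_⟩
  rw [integral_finsetSum _ hint]
  have hterm : ∀ S ∈ (Finset.univ.erase i).powerset,
      ∫ z, (E S).indicator (fun _ => M.rankPrize S.card) z ∂(Measure.pi fun _ : Fin n => F) =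
      (F.real B ^ S.card * (1 - F.real B) ^ (n - 1 - S.card)) * M.rankPrize S.card := by
    intro S hS
    rw [integral_indicator (hEm S), setIntegral_const, hprob S hS, smul_eq_mul]
  rw [Finset.sum_congr rfl hterm, Finset.sum_powerset_apply_card
    (fun m => (F.real B ^ m * (1 - F.real B) ^ (n - 1 - m)) * M.rankPrize m)]
  have hn : (Finset.univ.erase i).card + 1 = n := by
    have := i.pos
    simp; omega
  rw [RankOrderContest.expectedPrize, hn]
  refine Finset.sum_congr rfl fun m _ => ?_
  simp [nsmul_eq_mul, mul_assoc]

/-! ### Payoffs against a pure strategy -/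

/-- The pure strategy "participate iff the type lies in `A`", as a mixed strategy that ignores the
randomization device. -/
noncomputable def pureStrategy {A : Set AgentType} (hA : MeasurableSet A) : MixedStrategy where
  play _ x := open Classical in decide (x ∈ A)
  measurable_play := by
    classical
    refine measurable_to_bool ?_
    have : (Function.uncurry fun (_ : unitInterval) (x : AgentType) => decide (x ∈ A)) ⁻¹' {true}
        = Prod.snd ⁻¹' A := by
      ext ⟨ω, x⟩; simp
    rw [this]
    exact measurable_snd hA

lemma volume_quality_eq (q : ℝ) : volume {x : AgentType | x.1 = q} = 0 := by
  have : {x : AgentType | x.1 = q} = {q} ×ˢ Set.univ := by ext; simp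
  rw [this, Measure.volume_eq_prod, Measure.prod_prod]; simp

lemma volume_cost_eq {f : ℝ → ℝ} (hf : Measurable f) :
    volume {x : AgentType | x.2 = f x.1} = 0 := by
  rw [Measure.volume_eq_prod, Measure.measure_prod_null
    (show MeasurableSet {x : AgentType | x.2 = f x.1} from
      measurableSet_eq_fun measurable_snd (hf.comp measurable_fst))]
  refine Eventually.of_forall fun q => ?_
  have : Prod.mk q ⁻¹' {x : AgentType | x.2 = f x.1} = {f q} := by ext; simp
  simp [this]

/-- If all opponents of `i` participate exactly on `A`, then her payoff at type `x` is the
probability that she participates times the expected prize net of her cost. -/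
lemma RankOrderContest.payoff_eq (M : RankOrderContest n) {F : Measure AgentType}
    [IsProbabilityMeasure F] (hF : F ≪ volume) {A : Set AgentType} (hA : MeasurableSet A)
    (s : Fin n → MixedStrategy) (i : Fin n) (hs : ∀ j, j ≠ i → s j = pureStrategy hA)
    (x : AgentType) :
    M.payoff F s i x = (volume : Measure unitInterval).real {ω | (s i).play ω x = true} *
      (M.expectedPrize (F.real (A ∩ {y | x.1 < y.1})) - x.2) := by
  classical
  set B : Set AgentType := A ∩ {y | x.1 < y.1} with hBdef
  have hB : MeasurableSet B := hA.inter (measurableSet_lt measurable_const measurable_fst)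
  set T : Set unitInterval := {ω | (s i).play ω x = true} with hTdef
  have hT : MeasurableSet T := by
    have h : Measurable fun ω : unitInterval => (s i).play ω x :=
      (s i).measurable_play.comp (measurable_id.prodMk measurable_const)
    exact h (measurableSet_singleton true)
  have hnull : ∀ᵐ z ∂((Measure.pi fun _ : Fin n => F).prod
      (Measure.pi fun _ : Fin n => (volume : Measure unitInterval))),
      ∀ j, (z.1 j).1 ≠ x.1 := by
    refine Measure.quasiMeasurePreserving_fst.ae (p := fun t : Fin n → AgentType =>
      ∀ j, (t j).1 ≠ x.1) ?_
    refine ae_all_iff.2 fun j => ?_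
    have h : ∀ᵐ y ∂F, y.1 ≠ x.1 := by
      refine hF.ae_le ?_
      exact measure_eq_zero_iff_ae_notMem.1 (volume_quality_eq x.1)
    exact (Measure.tendsto_eval_ae_ae (μ := fun _ : Fin n => F) (i := j)).eventually h
  -- Almost surely the utility is a function of the types times one of the agent's own device.
  have hint : ∀ᵐ z ∂((Measure.pi fun _ : Fin n => F).prod
      (Measure.pi fun _ : Fin n => (volume : Measure unitInterval))),
      M.utility (Function.update z.1 i x)
        (fun j => (s j).play (z.2 j) (Function.update z.1 i x j)) i =
      (M.rankPrize (Finset.univ.filter fun j => j ≠ i ∧ z.1 j ∈ B).card - x.2) *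
        T.indicator 1 (z.2 i) := by
    filter_upwards [hnull] with z hz
    by_cases hp : z.2 i ∈ T
    · have hp' : (s i).play (z.2 i) x = true := hp
      rw [Set.indicator_of_mem hp, RankOrderContest.utility, Function.update_self,
        M.prizeOf_of_no_ties]
      · simp only [hp', if_true, Pi.one_apply, mul_one, Function.update_self]
        congr 3
        ext j
        simp only [Finset.mem_filter, Finset.mem_univ, true_and]
        refine and_congr_right fun hj => ?_
        simp [hs j hj, hj, pureStrategy, hBdef]
      · intro j hj
        simpa [hj] using hz j
    · have hp' : ¬ (s i).play (z.2 i) x = true := hp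
      rw [Set.indicator_of_notMem hp, RankOrderContest.utility, Function.update_self, if_neg hp',
        mul_zero]
  rw [RankOrderContest.payoff, integral_congr_ae hint,
    integral_prod_mul (f := fun t : Fin n → AgentType =>
      M.rankPrize (Finset.univ.filter fun j => j ≠ i ∧ t j ∈ B).card - x.2)
      (g := fun w : Fin n → unitInterval => T.indicator (1 : unitInterval → ℝ) (w i)),
    mul_comm]
  congr 1
  · rw [integral_comp_eval (μ := fun _ : Fin n => (volume : Measure unitInterval)) (i := i)
      (f := T.indicator (1 : unitInterval → ℝ))
      (measurable_one.indicator hT).aestronglyMeasurable, integral_indicator_one hT]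
  · obtain ⟨hI, hE⟩ := M.integral_rankPrize_card F hB i
    rw [integral_sub hI (integrable_const _), hE]
    simp

/-! ### The delayed equation -/

/-- The `j`-th iterate, started at zero, of the operator taking `G` to
`q ↦ F {(q', c') | c' ≤ V (G (q' + 1 / (k + 1))), q < q' ≤ k}`. -/
noncomputable def delayIter (F : Measure AgentType) (V : ℝ → ℝ) (k : ℕ) : ℕ → ℝ → ℝ
  | 0 => 0
  | j + 1 => fun q => F.real {x | x.2 ≤ V (delayIter F V k j (x.1 + 1 / ((k : ℝ) + 1))) ∧
      q < x.1 ∧ x.1 ≤ k}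

section

variable (F : Measure AgentType) (V : ℝ → ℝ) (k : ℕ)

lemma delayIter_succ (j : ℕ) (q : ℝ) :
    delayIter F V k (j + 1) q =
      F.real {x | x.2 ≤ V (delayIter F V k j (x.1 + 1 / ((k : ℝ) + 1))) ∧ q < x.1 ∧ x.1 ≤ k} :=
  rfl

/-- The values of the next iterate at `q` depend only on those of the previous one above
`q + 1 / (k + 1)`, so each iteration extends the region of stability downwards by the delay. -/
lemma delayIter_succ_eq (j : ℕ) (q : ℝ) (hq : (k : ℝ) - j * (1 / ((k : ℝ) + 1)) ≤ q) :
    delayIter F V k (j + 1) q = delayIter F V k j q := by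
  induction j generalizing q with
  | zero =>
    rw [delayIter_succ]
    have : {x : AgentType | x.2 ≤ V (delayIter F V k 0 (x.1 + 1 / ((k : ℝ) + 1))) ∧
        q < x.1 ∧ x.1 ≤ k} = ∅ := by
      refine eq_empty_of_forall_notMem fun x hx => ?_
      simp at hq
      linarith [hx.2.1, hx.2.2]
    rw [this]
    simp [delayIter]
  | succ j ih =>
    rw [delayIter_succ, delayIter_succ F V k j]
    congr 1
    ext x
    refine and_congr_left fun hx => ?_
    rw [ih]
    push_cast at hq
    linarith [hx.1]

variable [IsProbabilityMeasure F]

lemma delayIter_mem_Icc (j : ℕ) (q : ℝ) : delayIter F V k j q ∈ Icc (0 : ℝ) 1 := by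
  cases j with
  | zero => simp [delayIter]
  | succ j => exact ⟨measureReal_nonneg, measureReal_le_one⟩

lemma antitone_delayIter (j : ℕ) : Antitone (delayIter F V k j) := by
  cases j with
  | zero => exact antitone_const
  | succ j => exact fun q r hqr =>
      measureReal_mono fun x hx => ⟨hx.1, hqr.trans_lt hx.2.1, hx.2.2⟩

/-- The iterates share a modulus of continuity, given by the distribution function of the
quality. -/
lemma abs_delayIter_sub_le (j : ℕ) (q r : ℝ) :
    |delayIter F V k j q - delayIter F V k j r| ≤
      |F.real {x | x.1 ≤ q} - F.real {x | x.1 ≤ r}| := by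
  wlog hqr : q ≤ r generalizing q r
  · rw [abs_sub_comm, abs_sub_comm (F.real _)]
    exact this r q (le_of_not_ge hqr)
  have hΦ : F.real {x | x.1 ≤ r} - F.real {x | x.1 ≤ q} = F.real {x | q < x.1 ∧ x.1 ≤ r} := by
    have hsub : {x : AgentType | x.1 ≤ q} ⊆ {x | x.1 ≤ r} := fun x hx => le_trans hx hqr
    rw [← measureReal_sdiff hsub (measurableSet_le measurable_fst measurable_const)]
    congr 1
    ext x
    simp [and_comm]
  rw [abs_of_nonneg (sub_nonneg.2 (antitone_delayIter F V k j hqr)),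
    abs_sub_comm, hΦ, abs_of_nonneg measureReal_nonneg, sub_le_iff_le_add]
  cases j with
  | zero => simp [delayIter]
  | succ j =>
    refine (measureReal_mono ?_).trans (measureReal_union_le _ _)
    intro x hx
    rcases le_or_gt x.1 r with h | h
    · exact Or.inl ⟨hx.2.1, h⟩
    · exact Or.inr ⟨hx.1, h, hx.2.2⟩

end

/-! ### Passage to the limit -/

/-- A sequence of functions with values in `[0, 1]` and a common modulus of continuity has a
pointwise convergent subsequence: compactness of `[0, 1] ^ ℚ` gives convergence at the rationals,
and equicontinuity extends it to all reals. -/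
lemma exists_subseq_tendsto {g : ℕ → ℝ → ℝ} {Φ : ℝ → ℝ} (hΦ : Continuous Φ)
    (hg : ∀ k q, g k q ∈ Icc (0 : ℝ) 1) (hgΦ : ∀ k q r, |g k q - g k r| ≤ |Φ q - Φ r|) :
    ∃ φ : ℕ → ℕ, StrictMono φ ∧ ∃ G : ℝ → ℝ,
      ∀ q, Tendsto (fun k => g (φ k) q) atTop (𝓝 (G q)) := by
  obtain ⟨L, -, φ, hφ, hL⟩ := (isCompact_univ_pi fun _ : ℚ => isCompact_Icc (a := (0 : ℝ))
    (b := 1)).tendsto_subseq (x := fun k (r : ℚ) => g k r) fun k r _ => hg k r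
  rw [tendsto_pi_nhds] at hL
  refine ⟨φ, hφ, ?_⟩
  have hcauchy : ∀ q, ∃ y, Tendsto (fun k => g (φ k) q) atTop (𝓝 y) := by
    refine fun q => cauchySeq_tendsto_of_complete (Metric.cauchySeq_iff'.2 fun ε hε => ?_)
    obtain ⟨r, hr⟩ : ∃ r : ℚ, |Φ q - Φ r| < ε / 4 := by
      obtain ⟨r, hr⟩ := Rat.denseRange_cast.exists_mem_open
        (Metric.isOpen_ball.preimage hΦ)
        ⟨q, Metric.mem_ball_self (x := Φ q) (by positivity : 0 < ε / 4)⟩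
      exact ⟨r, by simpa [Real.dist_eq, abs_sub_comm] using hr⟩
    obtain ⟨N, hN⟩ := Metric.cauchySeq_iff'.1 (hL r).cauchySeq (ε / 4) (by positivity)
    refine ⟨N, fun k hk => ?_⟩
    have h1 := hN k hk
    have h2 := (hgΦ (φ k) q r).trans_lt hr
    have h3 := (hgΦ (φ N) q r).trans_lt hr
    simp only [Function.comp_apply, Real.dist_eq] at h1 ⊢
    rw [abs_lt] at h1 h2 h3 ⊢
    constructor <;> linarith [h1.1, h1.2, h2.1, h2.2, h3.1, h3.2]
  choose G hG using hcauchy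
  exact ⟨G, hG⟩

lemma continuous_measureReal_quality_le {F : Measure AgentType} [IsProbabilityMeasure F]
    (hF : F ≪ volume) : Continuous fun q : ℝ => F.real {x : AgentType | x.1 ≤ q} := by
  have hm : ∀ q : ℝ, MeasurableSet {x : AgentType | x.1 ≤ q} := fun q =>
    measurableSet_le measurable_fst measurable_const
  refine continuous_iff_continuousAt.2 fun q => ?_
  refine (ENNReal.tendsto_toReal (measure_ne_top F _)).comp
    (tendsto_measure_of_ae_tendsto_indicator_of_isFiniteMeasure (𝓝 q) (hm q) hm ?_)
  filter_upwards [measure_eq_zero_iff_ae_notMem.1 (hF (volume_quality_eq q))] with x hx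
  rcases lt_or_gt_of_ne (show x.1 ≠ q from hx) with h | h
  · filter_upwards [lt_mem_nhds h] with r hr
    exact iff_of_true hr.le h.le
  · filter_upwards [gt_mem_nhds h] with r hr
    exact iff_of_false hr.not_ge h.not_ge

/-- Existence of a consistent participation profile: a function `G` such that, if exactly the types
with `c ≤ V (G q)` participate, then `G q` is the probability of participation with quality
above `q`. -/
theorem exists_eq_measureReal {F : Measure AgentType} [IsProbabilityMeasure F]
    (hF : F ≪ volume) {V : ℝ → ℝ} (hV : Continuous V) :
    ∃ G : ℝ → ℝ, Measurable G ∧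
      ∀ q, F.real ({x | x.2 ≤ V (G x.1)} ∩ {x | q < x.1}) = G q := by
  set Φ : ℝ → ℝ := fun q => F.real {x : AgentType | x.1 ≤ q} with hΦdef
  have hΦ : Continuous Φ := continuous_measureReal_quality_le hF
  -- After `2 * k * (k + 1)` steps of length `1 / (k + 1)` below `k`, the iterates are stable down
  -- to `-k`.
  set g : ℕ → ℝ → ℝ := fun k => delayIter F V k (2 * k * (k + 1)) with hg
  have hgm : ∀ k, Measurable (g k) := fun k => (antitone_delayIter F V k _).measurable
  have hgfix : ∀ k : ℕ, ∀ q : ℝ, -(k : ℝ) ≤ q →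
      F.real {x | x.2 ≤ V (g k (x.1 + 1 / ((k : ℝ) + 1))) ∧ q < x.1 ∧ x.1 ≤ k} = g k q := by
    intro k q hq
    refine delayIter_succ_eq F V k (2 * k * (k + 1)) q (le_trans (le_of_eq ?_) hq)
    push_cast
    field_simp
    ring
  obtain ⟨φ, hφ, G, hG⟩ := exists_subseq_tendsto (g := g) hΦ
    (fun k q => delayIter_mem_Icc F V k _ q) (fun k q r => abs_delayIter_sub_le F V k _ q r)
  have hGm : Measurable G :=
    measurable_of_tendsto_metrizable (fun k => hgm (φ k)) (tendsto_pi_nhds.2 hG)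
  have hshift : ∀ q, Tendsto (fun k => g (φ k) (q + 1 / ((φ k : ℝ) + 1))) atTop (𝓝 (G q)) := by
    intro q
    have h0 : Tendsto (fun k => q + 1 / ((φ k : ℝ) + 1)) atTop (𝓝 q) := by
      simpa using tendsto_const_nhds.add
        ((tendsto_one_div_add_atTop_nhds_zero_nat (𝕜 := ℝ)).comp hφ.tendsto_atTop)
    have h1 : Tendsto (fun k => |Φ (q + 1 / ((φ k : ℝ) + 1)) - Φ q|) atTop (𝓝 0) := by
      simpa using (((hΦ.tendsto q).comp h0).sub_const (Φ q)).abs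
    have h2 : Tendsto (fun k => g (φ k) (q + 1 / ((φ k : ℝ) + 1)) - g (φ k) q) atTop (𝓝 0) :=
      squeeze_zero_norm (fun k => abs_delayIter_sub_le F V (φ k) _ _ _) h1
    simpa using h2.add (hG q)
  refine ⟨G, hGm, fun q => tendsto_nhds_unique ?_ (hG q)⟩
  have hev : ∀ᶠ k in atTop, F.real {x | x.2 ≤ V (g (φ k) (x.1 + 1 / ((φ k : ℝ) + 1))) ∧
      q < x.1 ∧ x.1 ≤ φ k} = g (φ k) q := by
    filter_upwards [(tendsto_natCast_atTop_atTop.comp hφ.tendsto_atTop).eventually_ge_atTop (-q)]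
      with k hk
    exact hgfix (φ k) q (by simp at hk; linarith)
  refine Tendsto.congr' hev ((ENNReal.tendsto_toReal (measure_ne_top F _)).comp
    (tendsto_measure_of_ae_tendsto_indicator_of_isFiniteMeasure atTop ?_ ?_ ?_))
  · exact (measurableSet_le measurable_snd (hV.measurable.comp (hGm.comp measurable_fst))).inter
      (measurableSet_lt measurable_const measurable_fst)
  · intro k
    exact (measurableSet_le measurable_snd (hV.measurable.comp
      ((hgm (φ k)).comp (measurable_fst.add_const _)))).inter
      ((measurableSet_lt measurable_const measurable_fst).inter
        (measurableSet_le measurable_fst measurable_const))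
  · filter_upwards [measure_eq_zero_iff_ae_notMem.1
      (hF (volume_cost_eq (hV.measurable.comp hGm)))] with x hx
    have hlim : Tendsto (fun k => V (g (φ k) (x.1 + 1 / ((φ k : ℝ) + 1)))) atTop
        (𝓝 (V (G x.1))) := (hV.tendsto _).comp (hshift x.1)
    have hk := (tendsto_natCast_atTop_atTop.comp hφ.tendsto_atTop).eventually_ge_atTop x.1
    rcases lt_or_gt_of_ne (show x.2 ≠ V (G x.1) from hx) with h | h
    · filter_upwards [hlim.eventually_const_lt h, hk] with k h1 h2
      exact ⟨fun hx => ⟨h.le, hx.2.1⟩, fun hx => ⟨le_of_lt h1, hx.2, h2⟩⟩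
    · filter_upwards [hlim.eventually_lt_const h] with k h1
      exact iff_of_false (fun hx => (not_le.2 h1) hx.1) (fun hx => (not_le.2 h) hx.1)

end Contest

/-! ### Existence of equilibrium -/

theorem mainTheorem7 (n : ℕ) (M : Contest.RankOrderContest n)
    (F : MeasureTheory.Measure Contest.AgentType) [MeasureTheory.IsProbabilityMeasure F]
    (hF : MeasureTheory.Measure.AbsolutelyContinuous F MeasureTheory.volume) :
    ∃ μ : Contest.MixedStrategy, M.IsSymmetricEquilibrium F μ := by
  obtain ⟨G, hGm, hG⟩ := Contest.exists_eq_measureReal hF M.continuous_expectedPrize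
  have hA : MeasurableSet {x : Contest.AgentType | x.2 ≤ M.expectedPrize (G x.1)} :=
    measurableSet_le measurable_snd
      (M.continuous_expectedPrize.measurable.comp (hGm.comp measurable_fst))
  refine ⟨Contest.pureStrategy hA, fun i x τ => ?_⟩
  rw [M.payoff_eq hF hA _ i (fun j hj => by simp [hj]) x,
    M.payoff_eq hF hA _ i (fun _ _ => rfl) x, hG, Function.update_self]
  by_cases hx : x.2 ≤ M.expectedPrize (G x.1)
  · have hplay : {ω | (Contest.pureStrategy hA).play ω x = true} = Set.univ := by
      ext ω; simp [Contest.pureStrategy, hx]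
    rw [hplay, probReal_univ]
    exact mul_le_mul_of_nonneg_right measureReal_le_one (sub_nonneg.2 hx)
  · have hplay : {ω | (Contest.pureStrategy hA).play ω x = true} = ∅ := by
      ext ω; simp [Contest.pureStrategy, hx]
    rw [hplay, measureReal_empty, zero_mul]
    exact mul_nonpos_of_nonneg_of_nonpos measureReal_nonneg (sub_nonpos.2 (not_le.1 hx).le)
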